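/- **Theorem 1.1.** Let $d\in\mathbb N$ and let $\mathfrak B$, with inner product $[\,\cdot\,,\cdot\,]_{\mathfrak B}$, be a finite-dimensional Pontryagin space of $d\times 1$ vector polynomials, that is, a finite-dimensional subspace of $\mathbb C^d[z]$ with a nondegenerate, possibly indefinite, Hermitian inner product. Let $K(z,w)$, $z,w\in\mathbb C$, be its reproducing kernel: the unique $d\times d$ matrix function such that, for all $w\in\mathbb C$ and $x\in\mathbb C^d$, $K(\cdot,w)x\in\mathfrak B$ and $[f,K(\cdot,w)x]_{\mathfrak B}=x^*f(w)$ for all $f\in\mathfrak B$. Let $S_{\mathfrak B}$ be the operator $f(z)\mapsto zf(z)$ in $\mathfrak B$ with domain $\{f\in\mathfrak B: zf(z)\in\mathfrak B\}$, and let $E_\alpha f=f(\alpha)$ be evaluation at $\alpha\in\mathbb C$. $K$ is called a *polynomial Nevanlinna kernel* if there are $d\times d$ matrix polynomials $M(z)$, $N(z)$ such that $$K(z,w)=K_{M,N}(z,w):=\frac{M(z)N(w)^*-N(z)M(w)^*}{z-w^*}\qquad (z,w\in\mathbb C,\ z\ne w^*),$$ $M(z)N(z^*)^*-N(z)M(z^*)^*=0$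 for all $z\in\mathbb C$, and $\operatorname{rank}[\,M(z)\ \ N(z)\,]=d$ for at least one $z\in\mathbb C$ (here $w^*$ denotes the complex conjugate of $w$). It is called *full* if $M$, $N$ can be chosen such that, in addition, $\operatorname{rank}[\,M(z)\ \ N(z)\,]=d$ for all $z\in\mathbb C$. Then $K$ is a polynomial Nevanlinna kernel if and only if the following two conditions hold: (A) $S_{\mathfrak B}$ is symmetric in $\mathfrak B$, that is, $[S_{\mathfrak B}f,g]_{\mathfrak B}=[f,S_{\mathfrak B}g]_{\mathfrak B}$ for all $f,g\in\operatorname{dom}S_{\mathfrak B}$; (B) for some $\alpha\in\mathbb C$, $\operatorname{ran}(S_{\mathfrak B}-\alpha)=\mathfrak B\cap\ker E_\alpha$. In this case, the Nevanlinna kernel $K$ is full if and only if the equality in (B) holds for all $\alpha\in\mathbb C$. -/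

import Mathlib

namespace PolyPontryagin

open scoped ComplexConjugate

/-- `d × 1` vector polynomials over `ℂ`. -/
abbrev VecPoly (d : ℕ) : Type := Fin d → Polynomial ℂ

/-- `d × d` matrix polynomials over `ℂ`. -/
abbrev MatPoly (d : ℕ) : Type := Matrix (Fin d) (Fin d) (Polynomial ℂ)

/-- Evaluation `f ↦ f(α)` of vector polynomials. -/
noncomputable def evalAt {d : ℕ} (α : ℂ) : VecPoly d →ₗ[ℂ] (Fin d → ℂ) where
  toFun f := fun i => (f i).eval α
  map_add' f g := by ext i; simp
  map_smul' c f := by ext i; simp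

/-- Multiplication by the independent variable on all vector polynomials. -/
noncomputable def mulZ {d : ℕ} : VecPoly d →ₗ[ℂ] VecPoly d where
  toFun f := fun i => Polynomial.X * f i
  map_add' f g := by ext1 i; simp [mul_add]
  map_smul' c f := by ext1 i; simp

/-- The value `M(z)` of a matrix polynomial. -/
noncomputable def matEval {d : ℕ} (M : MatPoly d) (z : ℂ) : Matrix (Fin d) (Fin d) ℂ :=
  M.map (Polynomial.eval z)

/-- A finite-dimensional Pontryagin space of `d × 1` vector polynomials: a finite-dimensional
linear space of vector polynomials with a nondegenerate, possibly indefinite, Hermitian inner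
product `[f, g]`, linear in `f` and conjugate-linear in `g`.  (In finite dimension every such inner
product has a fundamental decomposition into a positive and a negative definite subspace, and
completeness is automatic.) -/
structure PontryaginSpace (d : ℕ) where
  carrier : Submodule ℂ (VecPoly d)
  finiteDimensional : FiniteDimensional ℂ carrier
  form : carrier →ₗ[ℂ] carrier →ₗ⋆[ℂ] ℂ
  hermitian : ∀ f g, form g f = conj (form f g)
  nondegenerate : ∀ f, (∀ g, form f g = 0) → f = 0

namespace PontryaginSpace

variable {d : ℕ} (B : PontryaginSpace d)

/-- The operator `S` of multiplication by `z` in the space, with its maximal domain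
`{f ∈ B | z f ∈ B}`. -/
noncomputable def S : B.carrier →ₗ.[ℂ] B.carrier where
  domain := (B.carrier.comap mulZ).comap B.carrier.subtype
  toFun := LinearMap.codRestrict B.carrier
    (mulZ ∘ₗ B.carrier.subtype ∘ₗ ((B.carrier.comap mulZ).comap B.carrier.subtype).subtype)
    (fun f => f.2)

/-- `S` is symmetric: `[S f, g] = [f, S g]` for all `f, g` in the domain of `S`. -/
def IsSymmetric : Prop :=
  ∀ f g : B.S.domain, B.form (B.S f) g = B.form f (B.S g)

/-- `ran (S - α)`, as a subspace of the space of all vector polynomials. -/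
noncomputable def ranShift (α : ℂ) : Submodule ℂ (VecPoly d) :=
  (LinearMap.range (B.S.toFun - α • B.S.domain.subtype)).map B.carrier.subtype

/-- `ran (S - α) = B ∩ ker E_α`. -/
def RangeCondition (α : ℂ) : Prop :=
  B.ranShift α = B.carrier ⊓ LinearMap.ker (evalAt α)

/-- `K` is a reproducing kernel of `B`: for all `w ∈ ℂ` and `x ∈ ℂ^d` the function `K(·, w) x`
belongs to `B` and `[f, K(·, w) x] = x^* f(w)` for all `f ∈ B`. -/
def IsReproducingKernel (K : ℂ → ℂ → Matrix (Fin d) (Fin d) ℂ) : Prop :=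
  ∀ (w : ℂ) (x : Fin d → ℂ), ∃ k : B.carrier,
    (∀ z, evalAt z (k : VecPoly d) = (K z w).mulVec x) ∧
    ∀ f : B.carrier, B.form f k = dotProduct (star x) (evalAt w (f : VecPoly d))

theorem form_right_inj {k k' : B.carrier} (h : ∀ f, B.form f k = B.form f k') : k = k' := by
  rw [← sub_eq_zero]
  refine B.nondegenerate _ fun g => ?_
  rw [B.hermitian g, map_sub, h g, sub_self, map_zero]

theorem exists_riesz (φ : B.carrier →ₗ[ℂ] ℂ) : ∃ k : B.carrier, ∀ f, B.form f k = φ f := by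
  have := B.finiteDimensional
  let Φ : B.carrier →ₗ⋆[ℂ] Module.Dual ℂ B.carrier := B.form.flip
  have h1 : (LinearMap.range Φ).dualCoannihilator = ⊥ := by
    rw [eq_bot_iff]
    intro f hf
    rw [Submodule.mem_dualCoannihilator] at hf
    exact B.nondegenerate f fun g => hf (Φ g) ⟨g, rfl⟩
  have h2 : LinearMap.range Φ = ⊤ := by
    rw [← Subspace.dualCoannihilator_dualAnnihilator_eq (W := LinearMap.range Φ), h1,
      Submodule.dualAnnihilator_bot]
  obtain ⟨k, hk⟩ := LinearMap.range_eq_top.1 h2 φ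
  exact ⟨k, fun f => congrArg (fun ψ => ψ f) hk⟩

theorem existsUnique_isReproducingKernel : ∃! K, B.IsReproducingKernel K := by
  have hex : ∀ (w : ℂ) (x : Fin d → ℂ), ∃ k : B.carrier,
      ∀ f : B.carrier, B.form f k = dotProduct (star x) (evalAt w (f : VecPoly d)) := fun w x =>
    B.exists_riesz
      { toFun := fun f => dotProduct (star x) (evalAt w (f : VecPoly d))
        map_add' := fun f g => by simp [dotProduct_add]
        map_smul' := fun c f => by simp [dotProduct_smul] }
  choose k hk using hex
  have kadd : ∀ w x y, k w (x + y) = k w x + k w y := fun w x y =>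
    B.form_right_inj fun f => by simp [hk, add_dotProduct]
  have ksmul : ∀ w (c : ℂ) x, k w (c • x) = c • k w x := fun w c x =>
    B.form_right_inj fun f => by simp [hk, smul_dotProduct]
  let L : ℂ → ℂ → ((Fin d → ℂ) →ₗ[ℂ] (Fin d → ℂ)) := fun z w =>
    { toFun := fun x => evalAt z (k w x : VecPoly d)
      map_add' := fun x y => by simp [kadd]
      map_smul' := fun c x => by simp [ksmul] }
  refine ⟨fun z w => LinearMap.toMatrix' (L z w), fun w x => ⟨k w x, fun z => ?_, hk w x⟩, ?_⟩
  · rw [LinearMap.toMatrix'_mulVec]; rfl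
  · intro K hK
    funext z w
    rw [← Matrix.toLin'_symm, LinearEquiv.eq_symm_apply]
    refine LinearMap.ext fun x => ?_
    obtain ⟨k', h1, h2⟩ := hK w x
    have : k' = k w x := B.form_right_inj fun f => by rw [h2, hk]
    rw [Matrix.toLin'_apply, ← h1, this]; rfl

/-- The reproducing kernel of `B`. -/
noncomputable def reproducingKernel : ℂ → ℂ → Matrix (Fin d) (Fin d) ℂ :=
  B.existsUnique_isReproducingKernel.choose

theorem isReproducingKernel_reproducingKernel : B.IsReproducingKernel B.reproducingKernel :=
  B.existsUnique_isReproducingKernel.choose_spec.1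

end PontryaginSpace

/-- The rank of the `d × 2d` matrix `[M(z)  N(z)]`. -/
noncomputable def pairRank {d : ℕ} (M N : MatPoly d) (z : ℂ) : ℕ :=
  (Matrix.fromCols (matEval M z) (matEval N z)).rank

/-- `M(z) N(z^*)^* - N(z) M(z^*)^* = 0` for all `z`, and `[M(z)  N(z)]` has rank `d` for at
least one `z`. -/
def IsNevanlinnaPair {d : ℕ} (M N : MatPoly d) : Prop :=
  (∀ z : ℂ, matEval M z * (matEval N (conj z)).conjTranspose
      - matEval N z * (matEval M (conj z)).conjTranspose = 0) ∧
  ∃ z : ℂ, pairRank M N z = d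

/-- `K(z, w) = (M(z) N(w)^* - N(z) M(w)^*) / (z - w^*)` for all `z ≠ w^*`. -/
def KernelRepresents {d : ℕ} (M N : MatPoly d) (K : ℂ → ℂ → Matrix (Fin d) (Fin d) ℂ) : Prop :=
  ∀ z w : ℂ, z ≠ conj w →
    K z w = (z - conj w)⁻¹ •
      (matEval M z * (matEval N w).conjTranspose - matEval N z * (matEval M w).conjTranspose)

/-- `K` is a polynomial Nevanlinna kernel. -/
def IsNevanlinnaKernel {d : ℕ} (K : ℂ → ℂ → Matrix (Fin d) (Fin d) ℂ) : Prop :=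
  ∃ M N : MatPoly d, IsNevanlinnaPair M N ∧ KernelRepresents M N K

/-- `K` is a full polynomial Nevanlinna kernel: the representing pair can be chosen such that
`[M(z)  N(z)]` has rank `d` for all `z`. -/
def IsFullNevanlinnaKernel {d : ℕ} (K : ℂ → ℂ → Matrix (Fin d) (Fin d) ℂ) : Prop :=
  ∃ M N : MatPoly d, IsNevanlinnaPair M N ∧ KernelRepresents M N K ∧
    ∀ z : ℂ, pairRank M N z = d

end PolyPontryagin

/-!
Write `E_z f = f(z)` and `K_w x = K(·, w) x`, so that `K_w` is the adjoint of `E_w`.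

*From a pair to the operator.* Let `K` be represented by `M, N`. The span of the quadruples
`(K_w x, w^* K_w x, N(w)^* x, M(w)^* x)` consists of `(f, f', u, v)` with `z f - f' = M u - N v`, and
`[f', g] = [f, S g]` for `g ∈ dom S`. Every element of the space is `f' - α f` for one of these
quadruples. If it vanishes at `α`, then `M(α) u = N(α) v`; when `[M  N]` has rank `d` at `α` and at
`α^*`, dimensions show that `u = N(α^*)^* y` and `v = M(α^*)^* y` for some `y`, and subtracting the
quadruple of `K_{α^*} y` makes the boundary values vanish without changing `f' - α f`. Then
`f' = z f`, so the given element is `(z - α) f` (`exists_mulZ_sub_eq`). This is the range condition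
at `α`, and it also shows that each element of `dom S` arises as such an `f`, whence symmetry.

*From the operator to a pair.* The rank of `E_z` is lower semicontinuous and `dim ran (S - z)` is
constant, so the range condition at one point gives it at some real `α`
(`exists_real_rangeCondition`). There `(S - α)⁻¹` extends to a self-adjoint operator `R` on the
whole space (`exists_selfAdjoint_resolvent`). The function `E_z (1 - (z - α) R)` vanishes on
`ker E_α`, hence equals `N(z) E_α` for a matrix polynomial `N`, and together with
`M(z) = (z - α) K(z, α)` one computes `M(z) N(w)^* - N(z) M(w)^* = (z - w^*) K(z, w)`
(`pair_mul_sub_mul`). Adding to `N` a polynomial `G` with `G(z) E_α = 0` changes nothing, and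
`[M(z)  N(z)]` has rank `d` as soon as `ran E_z + ran G(z) = ℂ^d` (`exists_pair`). A constant
projection `G` achieves this at `z = α`. If the range condition holds everywhere, the
`ℂ[z]`-module generated by the space is saturated and therefore has a complement; the projection and
the section of this complement provide a `G` that works at every `z` (`isFullNevanlinnaKernel`).
-/

namespace PolyPontryagin

open scoped ComplexConjugate
open Polynomial

variable {d : ℕ}

/-! ### Vector and matrix polynomials -/

@[simp]
theorem evalAt_apply (α : ℂ) (f : VecPoly d) (i : Fin d) : evalAt α f i = (f i).eval α := rfl

@[simp]
theorem mulZ_apply (f : VecPoly d) (i : Fin d) : mulZ f i = X * f i := rfl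

@[simp]
theorem evalAt_mulZ (α : ℂ) (f : VecPoly d) : evalAt α (mulZ f) = α • evalAt α f := by
  ext i; simp

theorem vecPoly_eq_zero_of_infinite {s : Set ℂ} (hs : s.Infinite) {f : VecPoly d}
    (h : ∀ z ∈ s, evalAt z f = 0) : f = 0 := by
  funext i
  exact Polynomial.eq_zero_of_infinite_isRoot _
    (hs.mono fun z hz => congrFun (h z hz) i)

theorem vecPoly_ext {f g : VecPoly d} (h : ∀ z, evalAt z f = evalAt z g) : f = g := by
  rw [← sub_eq_zero]
  exact vecPoly_eq_zero_of_infinite (Set.infinite_univ (α := ℂ)) fun z _ => by simp [h z]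

theorem infinite_ne (a : ℂ) : {w : ℂ | w ≠ a}.Infinite :=
  (Set.finite_singleton a).infinite_compl

theorem mulZ_sub_smul_injective (α : ℂ) {f g : VecPoly d}
    (h : mulZ f - α • f = mulZ g - α • g) : f = g := by
  rw [← sub_eq_zero]
  refine vecPoly_eq_zero_of_infinite (infinite_ne α) fun z hz => ?_
  have h1 := congrArg (evalAt z) h
  simp only [map_sub, evalAt_mulZ, map_smul, ← sub_smul] at h1
  rw [map_sub, sub_eq_zero]
  exact smul_right_injective _ (sub_ne_zero.2 hz) h1

/-- The matrix polynomial whose columns are the images of the standard basis vectors. -/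
noncomputable def matPolyOfLin (T : (Fin d → ℂ) →ₗ[ℂ] VecPoly d) : MatPoly d :=
  Matrix.of fun i j => T (Pi.single j 1) i

theorem matEval_matPolyOfLin (T : (Fin d → ℂ) →ₗ[ℂ] VecPoly d) (z : ℂ) :
    matEval (matPolyOfLin T) z = LinearMap.toMatrix' (evalAt z ∘ₗ T) := by
  ext i j
  simp [matEval, matPolyOfLin, LinearMap.toMatrix'_apply]

theorem matEval_matPolyOfLin_mulVec (T : (Fin d → ℂ) →ₗ[ℂ] VecPoly d) (z : ℂ) (x : Fin d → ℂ) :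
    (matEval (matPolyOfLin T) z).mulVec x = evalAt z (T x) := by
  rw [matEval_matPolyOfLin, LinearMap.toMatrix'_mulVec]; rfl

theorem eval_det (H : MatPoly d) (z : ℂ) : H.det.eval z = (matEval H z).det := by
  rw [← Polynomial.coe_evalRingHom, RingHom.map_det]; rfl

/-- A matrix polynomial which is invertible at one point is invertible at some real point. -/
theorem exists_real_det_ne_zero (H : MatPoly d) {z₀ : ℂ} (h : (matEval H z₀).det ≠ 0) :
    ∃ α : ℝ, (matEval H α).det ≠ 0 := by
  by_contra! hc
  have h0 : H.det = 0 := by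
    refine Polynomial.eq_zero_of_infinite_isRoot _
      ((Set.infinite_range_of_injective Complex.ofReal_injective).mono ?_)
    rintro _ ⟨α, rfl⟩
    exact (eval_det H α).trans (hc α)
  apply h
  rw [← eval_det, h0, eval_zero]

/-! ### Pairs of full rank -/

/-- `[M(z)  N(z)]` has full rank if and only if it has no left null vector. -/
theorem pairRank_eq_iff (M N : MatPoly d) (z : ℂ) :
    pairRank M N z = d ↔
      ∀ x : Fin d → ℂ, Matrix.vecMul x (matEval M z) = 0 → Matrix.vecMul x (matEval N z) = 0 →
        x = 0 := by
  have h1 : pairRank M N z = d ↔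
      LinearIndependent ℂ (Matrix.fromCols (matEval M z) (matEval N z)).row := by
    rw [linearIndependent_iff_card_eq_finrank_span, pairRank, Matrix.rank_eq_finrank_span_row,
      Fintype.card_fin, Set.finrank]
    exact eq_comm
  rw [h1, ← Matrix.vecMul_injective_iff]
  refine (injective_iff_map_eq_zero
    (Matrix.vecMulLinear (Matrix.fromCols (matEval M z) (matEval N z)))).trans ?_
  refine forall_congr' fun x => ?_
  rw [Matrix.vecMulLinear_apply, Matrix.vecMul_fromCols, ← and_imp]
  refine imp_congr_left ⟨fun h => ?_, fun h => ?_⟩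
  · exact ⟨funext fun i => congrFun h (Sum.inl i), funext fun i => congrFun h (Sum.inr i)⟩
  · rw [h.1, h.2]; ext (i | i) <;> rfl

/-- `[M(z)  N(z)]` has full rank if and only if it has a right inverse. -/
theorem pairRank_eq_iff_exists_right_inverse (M N : MatPoly d) (z : ℂ) :
    pairRank M N z = d ↔
      ∃ X Y : Matrix (Fin d) (Fin d) ℂ, matEval M z * X + matEval N z * Y = 1 := by
  constructor
  · intro h
    have hs : Function.Surjective
        (Matrix.fromCols (matEval M z) (matEval N z)).mulVecLin := by
      rw [← LinearMap.range_eq_top]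
      apply Submodule.eq_top_of_finrank_eq
      rw [Module.finrank_fin_fun]
      exact h
    obtain ⟨g, hg⟩ := (Matrix.mulVec_surjective_iff_exists_right_inverse
      (A := Matrix.fromCols (matEval M z) (matEval N z))).1 hs
    refine ⟨g.toRows₁, g.toRows₂, ?_⟩
    rw [← Matrix.fromCols_mul_fromRows, Matrix.fromRows_toRows, hg]
  · rintro ⟨X, Y, h⟩
    rw [pairRank_eq_iff]
    intro x hM hN
    have := congrArg (Matrix.vecMul x) h
    rw [Matrix.vecMul_add, ← Matrix.vecMul_vecMul, ← Matrix.vecMul_vecMul, hM, hN] at this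
    simpa using this.symm

theorem exists_real_pairRank_eq (M N : MatPoly d) {z₀ : ℂ} (h : pairRank M N z₀ = d) :
    ∃ α : ℝ, pairRank M N α = d := by
  obtain ⟨X, Y, hXY⟩ := (pairRank_eq_iff_exists_right_inverse M N z₀).1 h
  have hev : ∀ z, matEval (M * X.map C + N * Y.map C) z = matEval M z * X + matEval N z * Y := by
    intro z
    ext i j
    simp [matEval, Matrix.mul_apply, Polynomial.eval_finsetSum]
  obtain ⟨α, hα⟩ := exists_real_det_ne_zero (M * X.map C + N * Y.map C) (z₀ := z₀)
    (by rw [hev, hXY]; simp)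
  refine ⟨α, (pairRank_eq_iff_exists_right_inverse M N α).2 ?_⟩
  rw [hev] at hα
  set H := matEval M α * X + matEval N α * Y
  refine ⟨X * H⁻¹, Y * H⁻¹, ?_⟩
  rw [← Matrix.mul_assoc, ← Matrix.mul_assoc, ← Matrix.add_mul]
  exact Matrix.mul_nonsing_inv _ (isUnit_iff_ne_zero.2 hα)

/-- By the rank hypotheses both sides of the inclusion `ran [N(α*)^*; M(α*)^*] ⊆ ker [M(α) -N(α)]`,
which is the identity `M(α) N(α*)^* = N(α) M(α*)^*`, have dimension `d`. -/
theorem IsNevanlinnaPair.exists_of_mulVec_eq {M N : MatPoly d} (hp : IsNevanlinnaPair M N) {α : ℂ}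
    (h1 : pairRank M N α = d) (h2 : pairRank M N (conj α) = d) {u v : Fin d → ℂ}
    (huv : (matEval M α).mulVec u = (matEval N α).mulVec v) :
    ∃ y, u = (matEval N (conj α)).conjTranspose.mulVec y ∧
      v = (matEval M (conj α)).conjTranspose.mulVec y := by
  let T : (Fin d → ℂ) →ₗ[ℂ] (Fin d → ℂ) × (Fin d → ℂ) :=
    (matEval N (conj α)).conjTranspose.mulVecLin.prod (matEval M (conj α)).conjTranspose.mulVecLin
  let A : (Fin d → ℂ) × (Fin d → ℂ) →ₗ[ℂ] (Fin d → ℂ) :=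
    (matEval M α).mulVecLin.coprod (-(matEval N α).mulVecLin)
  have hT : Function.Injective T := by
    rw [injective_iff_map_eq_zero]
    intro y hy
    have hyN : (matEval N (conj α)).conjTranspose.mulVec y = 0 := congrArg Prod.fst hy
    have hyM : (matEval M (conj α)).conjTranspose.mulVec y = 0 := congrArg Prod.snd hy
    rw [← star_eq_zero, Matrix.star_mulVec, Matrix.conjTranspose_conjTranspose] at hyN hyM
    exact star_eq_zero.1 ((pairRank_eq_iff M N _).1 h2 _ hyM hyN)
  have hA : Function.Surjective A := by
    obtain ⟨X, Y, h⟩ := (pairRank_eq_iff_exists_right_inverse M N α).1 h1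
    intro y
    refine ⟨(X.mulVec y, -Y.mulVec y), ?_⟩
    have := congrArg (fun H => Matrix.mulVec H y) h
    simp only [Matrix.add_mulVec, ← Matrix.mulVec_mulVec, Matrix.one_mulVec] at this
    simpa [A, Matrix.mulVec_neg] using this
  have hle : LinearMap.range T ≤ LinearMap.ker A := by
    rintro _ ⟨y, rfl⟩
    have := congrArg (fun H => Matrix.mulVec H y) (hp.1 α)
    simp only [Matrix.sub_mulVec, ← Matrix.mulVec_mulVec, Matrix.zero_mulVec] at this
    simpa [T, A, sub_eq_add_neg] using this
  have hfin := LinearMap.finrank_range_add_finrank_ker A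
  rw [LinearMap.range_eq_top.2 hA, finrank_top, Module.finrank_prod, Module.finrank_fin_fun] at hfin
  have heq : LinearMap.range T = LinearMap.ker A := by
    apply Submodule.eq_of_le_of_finrank_eq hle
    rw [LinearMap.finrank_range_of_inj hT, Module.finrank_fin_fun]
    omega
  have hmem : (u, v) ∈ LinearMap.range T := by
    rw [heq]
    simp [A, huv]
  obtain ⟨y, hy⟩ := hmem
  exact ⟨y, (congrArg Prod.fst hy).symm, (congrArg Prod.snd hy).symm⟩

namespace PontryaginSpace

variable (B : PontryaginSpace d)

/-! ### The multiplication operator and the reproducing kernel -/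

theorem isSymmetric_iff : B.IsSymmetric ↔ ∀ f f' g g' : B.carrier,
    (f' : VecPoly d) = mulZ (f : VecPoly d) → (g' : VecPoly d) = mulZ (g : VecPoly d) →
      B.form f' g = B.form f g' := by
  constructor
  · intro h f f' g g' hf hg
    have hf' : f ∈ B.S.domain := show mulZ (f : VecPoly d) ∈ B.carrier from hf ▸ f'.2
    have hg' : g ∈ B.S.domain := show mulZ (g : VecPoly d) ∈ B.carrier from hg ▸ g'.2
    rw [show f' = B.S ⟨f, hf'⟩ from Subtype.ext hf, show g' = B.S ⟨g, hg'⟩ from Subtype.ext hg]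
    exact h ⟨f, hf'⟩ ⟨g, hg'⟩
  · exact fun h f g => h _ _ _ _ rfl rfl

theorem mem_ranShift {α : ℂ} {f : VecPoly d} :
    f ∈ B.ranShift α ↔
      ∃ g ∈ B.carrier, mulZ g ∈ B.carrier ∧ mulZ g - α • g = f := by
  constructor
  · rintro ⟨_, ⟨g, rfl⟩, rfl⟩
    exact ⟨_, g.1.2, g.2, rfl⟩
  · rintro ⟨g, hg, hzg, rfl⟩
    exact ⟨_, ⟨⟨⟨g, hg⟩, hzg⟩, rfl⟩, rfl⟩

theorem ranShift_le (α : ℂ) :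
    B.ranShift α ≤ B.carrier ⊓ LinearMap.ker (evalAt α) := by
  intro f hf
  obtain ⟨g, hg, hzg, rfl⟩ := B.mem_ranShift.1 hf
  exact ⟨B.carrier.sub_mem hzg (B.carrier.smul_mem _ hg), by simp⟩

theorem rangeCondition_iff {α : ℂ} : B.RangeCondition α ↔
    ∀ f : B.carrier, evalAt α (f : VecPoly d) = 0 →
      ∃ g : B.carrier, mulZ (g : VecPoly d) - α • (g : VecPoly d) = f := by
  constructor
  · intro h f hf
    have h' : (f : VecPoly d) ∈ B.ranShift α := by
      rw [show B.ranShift α = _ from h]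
      exact ⟨f.2, hf⟩
    obtain ⟨g, hg, -, h⟩ := B.mem_ranShift.1 h'
    exact ⟨⟨g, hg⟩, h⟩
  · intro h
    refine le_antisymm (B.ranShift_le α) fun f hf => ?_
    obtain ⟨g, hg⟩ := h ⟨f, hf.1⟩ hf.2
    refine B.mem_ranShift.2 ⟨g, g.2, ?_, hg⟩
    rw [sub_eq_iff_eq_add.1 hg]
    exact B.carrier.add_mem hf.1 (B.carrier.smul_mem _ g.2)

/-- Evaluation at `α` restricted to the space. -/
noncomputable def evalOn (α : ℂ) : B.carrier →ₗ[ℂ] (Fin d → ℂ) :=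
  evalAt α ∘ₗ B.carrier.subtype

@[simp]
theorem evalOn_apply (α : ℂ) (f : B.carrier) : B.evalOn α f = evalAt α (f : VecPoly d) := rfl

/-- The element `K(·, w) x` of the space, as a linear function of `x`; this is the adjoint of
evaluation at `w`. -/
noncomputable def kernelVec (w : ℂ) : (Fin d → ℂ) →ₗ[ℂ] B.carrier where
  toFun x := (B.isReproducingKernel_reproducingKernel w x).choose
  map_add' x y := B.form_right_inj fun f => by
    have h := fun x => (B.isReproducingKernel_reproducingKernel w x).choose_spec.2 f
    rw [map_add, h, h, h, star_add, add_dotProduct]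
  map_smul' c x := B.form_right_inj fun f => by
    have h := fun x => (B.isReproducingKernel_reproducingKernel w x).choose_spec.2 f
    rw [map_smulₛₗ, h, h, star_smul, smul_dotProduct]
    rfl

theorem evalAt_kernelVec (z w : ℂ) (x : Fin d → ℂ) :
    evalAt z (B.kernelVec w x : VecPoly d) = (B.reproducingKernel z w).mulVec x :=
  (B.isReproducingKernel_reproducingKernel w x).choose_spec.1 z

theorem form_kernelVec (f : B.carrier) (w : ℂ) (x : Fin d → ℂ) :
    B.form f (B.kernelVec w x) = dotProduct (star x) (evalAt w (f : VecPoly d)) :=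
  (B.isReproducingKernel_reproducingKernel w x).choose_spec.2 f

theorem conjTranspose_reproducingKernel (z w : ℂ) :
    (B.reproducingKernel z w).conjTranspose = B.reproducingKernel w z := by
  ext i j
  have h := B.hermitian (B.kernelVec w (Pi.single i 1)) (B.kernelVec z (Pi.single j 1))
  rw [form_kernelVec, form_kernelVec, evalAt_kernelVec, evalAt_kernelVec] at h
  simpa [Pi.star_single] using h.symm

/-- The functions `K(·, w) x` with `w ≠ a` span the space: an element orthogonal to them vanishes
off `a`, hence identically. -/
theorem eq_top_of_kernelVec_mem (a : ℂ) {U : Submodule ℂ B.carrier}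
    (h : ∀ w ≠ a, ∀ x, B.kernelVec w x ∈ U) : U = ⊤ := by
  by_contra hU
  obtain ⟨φ, hφ, hUφ⟩ := Submodule.exists_le_ker_of_lt_top U (lt_top_iff_ne_top.2 hU)
  obtain ⟨k, hk⟩ := B.exists_riesz φ
  apply hφ
  have hk0 : k = 0 := by
    apply Subtype.ext
    refine vecPoly_eq_zero_of_infinite (infinite_ne a) fun w hw => ?_
    refine dotProduct_eq_zero _ fun x => ?_
    have h1 : φ (B.kernelVec w (star x)) = 0 := hUφ (h w hw _)
    rw [← hk, B.hermitian, form_kernelVec, map_eq_zero, star_star] at h1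
    rw [dotProduct_comm, h1]
  ext f
  rw [← hk, hk0, map_zero, LinearMap.zero_apply]

theorem exists_adjoint (A : B.carrier →ₗ[ℂ] B.carrier) :
    ∃ A' : B.carrier →ₗ[ℂ] B.carrier, ∀ f g, B.form (A' f) g = B.form f (A g) := by
  have h : ∀ f, ∃ k : B.carrier, ∀ g, B.form g k = B.form (A g) f := fun f =>
    B.exists_riesz ((B.form.flip f) ∘ₗ A)
  choose k hk using h
  refine ⟨{ toFun := k, map_add' := fun f g => ?_, map_smul' := fun c f => ?_ }, fun f g => ?_⟩
  · exact B.form_right_inj fun h => by simp [hk]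
  · exact B.form_right_inj fun h => by simp [hk]
  · change B.form (k f) g = _
    rw [B.hermitian, hk, ← B.hermitian]

theorem exists_generalized_inverse (α : ℂ) :
    ∃ σ : (Fin d → ℂ) →ₗ[ℂ] B.carrier, ∀ f : B.carrier,
      evalAt α (σ (evalAt α (f : VecPoly d)) : VecPoly d) = evalAt α (f : VecPoly d) := by
  obtain ⟨s, hs⟩ := (B.evalOn α).rangeRestrict.exists_rightInverse_of_surjective
    (LinearMap.range_rangeRestrict _)
  obtain ⟨σ, hσ⟩ := s.exists_extend
  refine ⟨σ, fun f => ?_⟩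
  have h1 : σ (evalAt α (f : VecPoly d)) = s ((B.evalOn α).rangeRestrict f) :=
    congrArg (fun T => T ((B.evalOn α).rangeRestrict f)) hσ
  rw [h1]
  exact congrArg (fun T => ((T ((B.evalOn α).rangeRestrict f) : LinearMap.range (B.evalOn α)) :
    Fin d → ℂ)) hs

/-! ### The range condition at real points -/

/-- The dimension of `ran (S - α)` does not depend on `α`, while the rank of the evaluation is
lower semicontinuous, so the range condition carries over from one point to almost all others. -/
theorem exists_real_rangeCondition {α₀ : ℂ} (h : B.RangeCondition α₀) :
    ∃ α : ℝ, B.RangeCondition α := by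
  have := B.finiteDimensional
  obtain ⟨σ, hσ⟩ := B.exists_generalized_inverse α₀
  -- `H(z) = E_z σ + (1 - E_{α₀} σ)` equals `1` at `α₀` and `E_z σ` on `ran E_{α₀}`.
  let T : (Fin d → ℂ) →ₗ[ℂ] VecPoly d :=
    B.carrier.subtype ∘ₗ σ +
      (LinearMap.pi fun i => (CAlgHom (R := ℂ)).toLinearMap ∘ₗ LinearMap.proj i) ∘ₗ
        (LinearMap.id - B.evalOn α₀ ∘ₗ σ)
  have hT : ∀ z x, evalAt z (T x) =
      evalAt z (σ x : VecPoly d) + (x - evalAt α₀ (σ x : VecPoly d)) := by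
    intro z x
    ext i
    simp [T]
  obtain ⟨α, hα⟩ := exists_real_det_ne_zero (matPolyOfLin T) (z₀ := α₀) (by
    rw [matEval_matPolyOfLin, show evalAt α₀ ∘ₗ T = LinearMap.id from
      LinearMap.ext fun x => by simp [hT], LinearMap.toMatrix'_id]
    simp)
  have hinj : Function.Injective (evalAt (α : ℂ) ∘ₗ T) := by
    rw [matEval_matPolyOfLin] at hα
    have := Matrix.mulVec_injective_of_isUnit
      ((Matrix.isUnit_iff_isUnit_det _).2 (isUnit_iff_ne_zero.2 hα))
    intro x y hxy
    apply this
    simpa only [LinearMap.toMatrix'_mulVec] using hxy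
  refine ⟨α, ?_⟩
  have hrank : Module.finrank ℂ (LinearMap.range (B.evalOn α₀)) ≤
      Module.finrank ℂ (LinearMap.range (B.evalOn α)) := by
    let A : LinearMap.range (B.evalOn α₀) →ₗ[ℂ] LinearMap.range (B.evalOn α) :=
      LinearMap.codRestrict _ ((evalAt (α : ℂ) ∘ₗ T) ∘ₗ Submodule.subtype _) (by
        rintro ⟨_, f, rfl⟩
        refine ⟨σ (B.evalOn α₀ f), ?_⟩
        change evalAt _ _ = evalAt (α : ℂ) (T (B.evalOn α₀ f))
        rw [hT]
        simp only [evalOn_apply, hσ, sub_self, add_zero]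
        rfl)
    refine LinearMap.finrank_le_finrank_of_injective (f := A) fun x y hxy => ?_
    exact Subtype.ext (hinj (congrArg Subtype.val hxy))
  -- `ran (S - z)` and `B ∩ ker E_z` pulled back to subspaces of `B`.
  let D : ℂ → B.S.domain →ₗ[ℂ] B.carrier := fun z => B.S.toFun - z • B.S.domain.subtype
  have hD : ∀ z, Module.finrank ℂ (LinearMap.range (D z)) = Module.finrank ℂ B.S.domain := by
    refine fun z => LinearMap.finrank_range_of_inj fun f g hfg => ?_
    exact Subtype.ext (Subtype.ext (mulZ_sub_smul_injective z (congrArg Subtype.val hfg)))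
  have hmap : ∀ z, (LinearMap.ker (B.evalOn z)).map B.carrier.subtype =
      B.carrier ⊓ LinearMap.ker (evalAt z) := by
    intro z
    rw [evalOn, LinearMap.ker_comp, Submodule.map_comap_subtype]
  have h0 : LinearMap.range (D α₀) = LinearMap.ker (B.evalOn α₀) :=
    Submodule.map_injective_of_injective B.carrier.injective_subtype (Eq.trans h (hmap α₀).symm)
  have h1 : LinearMap.range (D α) ≤ LinearMap.ker (B.evalOn α) := by
    rintro _ ⟨f, rfl⟩
    change evalAt (α : ℂ) (mulZ (f.1.1 : VecPoly d) - (α : ℂ) • (f.1.1 : VecPoly d)) = 0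
    rw [map_sub, map_smul, evalAt_mulZ, sub_self]
  have h2 : LinearMap.range (D α) = LinearMap.ker (B.evalOn α) := by
    apply Submodule.eq_of_le_of_finrank_le h1
    have e0 := LinearMap.finrank_range_add_finrank_ker (B.evalOn α₀)
    have e1 := LinearMap.finrank_range_add_finrank_ker (B.evalOn α)
    rw [← h0, hD] at e0
    rw [hD]
    omega
  change (LinearMap.range (D α)).map B.carrier.subtype = _
  rw [h2, hmap]

end PontryaginSpace

/-! ### Symmetry and range condition from a representing pair -/

theorem KernelRepresents.smul_eq {M N : MatPoly d} {K : ℂ → ℂ → Matrix (Fin d) (Fin d) ℂ}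
    (hK : KernelRepresents M N K) (hp : IsNevanlinnaPair M N) (z w : ℂ) :
    (z - conj w) • K z w = matEval M z * (matEval N w).conjTranspose -
      matEval N z * (matEval M w).conjTranspose := by
  by_cases h : z = conj w
  · have h0 := hp.1 z
    rw [show conj z = w by rw [h, Complex.conj_conj]] at h0
    rw [h0, h, sub_self, zero_smul]
  · rw [hK z w h, smul_smul, mul_inv_cancel₀ (sub_ne_zero.2 h), one_smul]

namespace PontryaginSpace

variable (B : PontryaginSpace d)

/-- The span of the quadruples `(K(·, w) x, w^* K(·, w) x, N(w)^* x, M(w)^* x)`. Its projection to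
the first two components is the adjoint relation of `S`, and the last two components are boundary
values: they satisfy `z f - f' = M u - N v`. -/
noncomputable def boundaryRelation (M N : MatPoly d) :
    Submodule ℂ (B.carrier × B.carrier × (Fin d → ℂ) × (Fin d → ℂ)) :=
  Submodule.span ℂ {q | ∃ w x, q = (B.kernelVec w x, conj w • B.kernelVec w x,
    (matEval N w).conjTranspose.mulVec x, (matEval M w).conjTranspose.mulVec x)}

variable {B}

theorem form_eq_of_mem_boundaryRelation {M N : MatPoly d}
    {q : B.carrier × B.carrier × (Fin d → ℂ) × (Fin d → ℂ)} (hq : q ∈ B.boundaryRelation M N)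
    {g g' : B.carrier} (hg : (g' : VecPoly d) = mulZ (g : VecPoly d)) :
    B.form q.2.1 g = B.form q.1 g' := by
  induction hq using Submodule.span_induction with
  | mem q h =>
    obtain ⟨w, x, rfl⟩ := h
    rw [B.hermitian g, B.hermitian g']
    simp [form_kernelVec, hg]
  | zero => simp
  | add p q _ _ hp hq => simp [hp, hq]
  | smul c q _ hq => simp [hq]

theorem evalAt_eq_of_mem_boundaryRelation {M N : MatPoly d} (hp : IsNevanlinnaPair M N)
    (hK : KernelRepresents M N B.reproducingKernel)
    {q : B.carrier × B.carrier × (Fin d → ℂ) × (Fin d → ℂ)} (hq : q ∈ B.boundaryRelation M N)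
    (z : ℂ) :
    z • evalAt z (q.1 : VecPoly d) - evalAt z (q.2.1 : VecPoly d) =
      (matEval M z).mulVec q.2.2.1 - (matEval N z).mulVec q.2.2.2 := by
  induction hq using Submodule.span_induction with
  | mem q h =>
    obtain ⟨w, x, rfl⟩ := h
    have := congrArg (fun A => Matrix.mulVec A x) (hK.smul_eq hp z w)
    simp only [Matrix.smul_mulVec, Matrix.sub_mulVec, ← Matrix.mulVec_mulVec] at this
    simp only [Submodule.coe_smul, map_smul, evalAt_kernelVec, ← sub_smul, this]
  | zero => simp
  | add p q _ _ hp hq =>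
    simp only [Prod.fst_add, Prod.snd_add, Submodule.coe_add, map_add, Matrix.mulVec_add, smul_add]
    rw [add_sub_add_comm, hp, hq, add_sub_add_comm]
  | smul c q _ hq =>
    simp only [Prod.smul_fst, Prod.smul_snd, Submodule.coe_smul, map_smul, Matrix.mulVec_smul]
    rw [smul_comm, ← smul_sub, hq, smul_sub]

theorem exists_mem_boundaryRelation_sub_eq (M N : MatPoly d) (α : ℂ) (f : B.carrier) :
    ∃ q ∈ B.boundaryRelation M N, q.2.1 - α • q.1 = f := by
  let D : B.carrier × B.carrier × (Fin d → ℂ) × (Fin d → ℂ) →ₗ[ℂ] B.carrier :=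
    LinearMap.fst ℂ _ _ ∘ₗ LinearMap.snd ℂ _ _ - α • LinearMap.fst ℂ _ _
  have h : (B.boundaryRelation M N).map D = ⊤ := by
    refine B.eq_top_of_kernelVec_mem (conj α) fun w hw x => ?_
    have hw' : conj w - α ≠ 0 := fun h => hw (by rw [← sub_eq_zero.1 h, Complex.conj_conj])
    refine ⟨_, Submodule.subset_span ⟨w, (conj w - α)⁻¹ • x, rfl⟩, ?_⟩
    change conj w • B.kernelVec w ((conj w - α)⁻¹ • x) -
      α • B.kernelVec w ((conj w - α)⁻¹ • x) = _
    have e : ∀ (a b : ℂ) (k : B.carrier), a • k - b • k = (a - b) • k := fun a b k => by module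
    rw [e, map_smul, smul_smul, mul_inv_cancel₀ hw', one_smul]
  have hf : f ∈ (B.boundaryRelation M N).map D := h ▸ Submodule.mem_top
  obtain ⟨q, hq, rfl⟩ := hf
  exact ⟨q, hq, rfl⟩

/-- If `f(α) = 0`, the boundary values of a quadruple with `f' - α f` prescribed lie in the kernel
of `[M(α) -N(α)]`, so they can be removed by subtracting the quadruple of some
`K(·, α^*) y`, which leaves `f' - α f` unchanged. -/
theorem exists_mulZ_sub_eq {M N : MatPoly d} (hp : IsNevanlinnaPair M N)
    (hK : KernelRepresents M N B.reproducingKernel) {α : ℂ} (h1 : pairRank M N α = d)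
    (h2 : pairRank M N (conj α) = d) {f : B.carrier} (hf : evalAt α (f : VecPoly d) = 0) :
    ∃ h h' : B.carrier, (h' : VecPoly d) = mulZ (h : VecPoly d) ∧ h' - α • h = f ∧
      ∀ g g' : B.carrier, (g' : VecPoly d) = mulZ (g : VecPoly d) →
        B.form h' g = B.form h g' := by
  obtain ⟨q, hq, hqf⟩ := exists_mem_boundaryRelation_sub_eq M N α f
  have e := evalAt_eq_of_mem_boundaryRelation hp hK hq α
  have e' : α • evalAt α (q.1 : VecPoly d) - evalAt α (q.2.1 : VecPoly d) = 0 := by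
    rw [← neg_sub, neg_eq_zero, ← map_smul, ← map_sub]
    rw [← hqf] at hf
    exact hf
  rw [e', eq_comm, sub_eq_zero] at e
  obtain ⟨y, hu, hv⟩ := hp.exists_of_mulVec_eq h1 h2 e
  obtain ⟨p, hpQ, hpe⟩ : ∃ p ∈ B.boundaryRelation M N, p =
      (B.kernelVec (conj α) y, α • B.kernelVec (conj α) y, q.2.2.1, q.2.2.2) :=
    ⟨_, Submodule.subset_span ⟨conj α, y, rfl⟩, by rw [hu, hv, Complex.conj_conj]⟩
  have hr := (B.boundaryRelation M N).sub_mem hq hpQ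
  refine ⟨(q - p).1, (q - p).2.1, ?_, ?_, fun g g' hg => form_eq_of_mem_boundaryRelation hr hg⟩
  · refine vecPoly_ext fun z => ?_
    have ez := evalAt_eq_of_mem_boundaryRelation hp hK hr z
    rw [evalAt_mulZ, eq_comm, ← sub_eq_zero, ez, hpe]
    simp
  · rw [← hqf, hpe]
    simp [smul_sub]

theorem rangeCondition_of_pairRank {M N : MatPoly d} (hp : IsNevanlinnaPair M N)
    (hK : KernelRepresents M N B.reproducingKernel) {α : ℂ} (h1 : pairRank M N α = d)
    (h2 : pairRank M N (conj α) = d) : B.RangeCondition α := by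
  refine B.rangeCondition_iff.2 fun f hf => ?_
  obtain ⟨h, h', hh, hf, -⟩ := exists_mulZ_sub_eq hp hK h1 h2 hf
  exact ⟨h, by rw [← hf, ← hh]; rfl⟩

theorem isSymmetric_of_pairRank {M N : MatPoly d} (hp : IsNevanlinnaPair M N)
    (hK : KernelRepresents M N B.reproducingKernel) {α : ℂ} (h1 : pairRank M N α = d)
    (h2 : pairRank M N (conj α) = d) : B.IsSymmetric := by
  refine B.isSymmetric_iff.2 fun f f' g g' hf hg => ?_
  obtain ⟨h, h', hh, he, hform⟩ := exists_mulZ_sub_eq hp hK h1 h2 (f := f' - α • f)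
    (by simp [hf])
  have he' : (h' : VecPoly d) - α • (h : VecPoly d) = f' - α • (f : VecPoly d) :=
    congrArg Subtype.val he
  have hfh : h = f := by
    apply Subtype.ext
    apply mulZ_sub_smul_injective α
    rw [← hh, ← hf, he']
  subst hfh
  rw [show f' = h' from Subtype.ext (hf.trans hh.symm)]
  exact hform g g' hg

variable (B)

/-! ### A representing pair from a self-adjoint extension -/

/-- A self-adjoint extension of the resolvent `(S - α)⁻¹` for real `α`. For an arbitrary
extension `R` with `(S - α) R f = f - P f`, where `P` projects along `B ∩ ker E_α`, the defect
`[R f, g] - [f, R g]` equals `[R f, P g] - [P f, R g]`, so that `R + R^* P` is self-adjoint. -/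
theorem exists_selfAdjoint_resolvent (hS : B.IsSymmetric) {α : ℝ} (h : B.RangeCondition α) :
    ∃ R : B.carrier →ₗ[ℂ] B.carrier, (∀ f g, B.form (R f) g = B.form f (R g)) ∧
      ∀ f : B.carrier, evalAt (α : ℂ) (f : VecPoly d) = 0 →
        mulZ (R f : VecPoly d) - (α : ℂ) • (R f : VecPoly d) = f := by
  obtain ⟨σ, hσ⟩ := B.exists_generalized_inverse α
  let P : B.carrier →ₗ[ℂ] B.carrier := σ ∘ₗ B.evalOn α
  have hex : ∀ f : B.carrier, ∃ g : B.carrier,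
      mulZ (g : VecPoly d) - (α : ℂ) • (g : VecPoly d) = f - (P f : VecPoly d) := fun f =>
    B.rangeCondition_iff.1 h (f - P f) (by
      have := hσ f
      simp only [Submodule.coe_sub, map_sub, sub_eq_zero]
      exact this.symm)
  choose r hr using hex
  let R : B.carrier →ₗ[ℂ] B.carrier :=
    { toFun := r
      map_add' := fun f g => Subtype.ext <| mulZ_sub_smul_injective (α : ℂ) <| by
        have e := hr (f + g)
        simp only [map_add, Submodule.coe_add, smul_add] at e ⊢
        rw [e, add_sub_add_comm, add_sub_add_comm, ← hr, ← hr]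
      map_smul' := fun c f => Subtype.ext <| mulZ_sub_smul_injective (α : ℂ) <| by
        have e := hr (c • f)
        simp only [map_smul, Submodule.coe_smul, RingHom.id_apply] at e ⊢
        rw [e, smul_comm (α : ℂ) c, ← smul_sub, ← smul_sub, ← hr] }
  have hR : ∀ f : B.carrier, ∃ k : B.carrier, (k : VecPoly d) = mulZ (R f : VecPoly d) ∧
      f = k - (α : ℂ) • R f + P f := by
    intro f
    have e : mulZ (R f : VecPoly d) =
        ((f - P f + (α : ℂ) • R f : B.carrier) : VecPoly d) := sub_eq_iff_eq_add.1 (hr f)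
    exact ⟨_, e.symm, by module⟩
  obtain ⟨R', hR'⟩ := B.exists_adjoint R
  have hsymm := B.isSymmetric_iff.1 hS
  refine ⟨R + R' ∘ₗ P, fun f g => ?_, fun f hf => ?_⟩
  · have hR'r : B.form f (R' (P g)) = B.form (R f) (P g) := by
      rw [B.hermitian, hR', ← B.hermitian]
    obtain ⟨k, hk, hkf⟩ := hR f
    obtain ⟨l, hl, hlg⟩ := hR g
    have e1 : B.form (R f) g =
        B.form (R f) l - (α : ℂ) * B.form (R f) (R g) + B.form (R f) (P g) := by
      conv_lhs => rw [hlg]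
      simp
    have e2 : B.form f (R g) =
        B.form k (R g) - (α : ℂ) * B.form (R f) (R g) + B.form (P f) (R g) := by
      conv_lhs => rw [hkf]
      simp
    simp only [LinearMap.add_apply, LinearMap.comp_apply, map_add]
    rw [hR', hR'r, e1, e2, hsymm _ _ _ _ hk hl]
    ring
  · have hP : P f = 0 := by
      change σ (evalAt (α : ℂ) (f : VecPoly d)) = 0
      rw [hf, map_zero]
    obtain ⟨k, hk, hkf⟩ := hR f
    rw [LinearMap.add_apply, LinearMap.comp_apply, hP, map_zero, add_zero, ← hk]
    rw [hP, add_zero] at hkf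
    exact (congrArg Subtype.val hkf).symm

/-- The matrix polynomial `(z - α) K(z, α)`. -/
noncomputable def shiftedKernelPoly (α : ℂ) : MatPoly d :=
  matPolyOfLin ((mulZ - α • LinearMap.id) ∘ₗ B.carrier.subtype ∘ₗ B.kernelVec α)

theorem matEval_shiftedKernelPoly_mulVec (α z : ℂ) (x : Fin d → ℂ) :
    (matEval (B.shiftedKernelPoly α) z).mulVec x =
      (z - α) • evalAt z (B.kernelVec α x : VecPoly d) := by
  rw [shiftedKernelPoly, matEval_matPolyOfLin_mulVec]
  simp [sub_smul]

theorem matEval_shiftedKernelPoly (α z : ℂ) :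
    matEval (B.shiftedKernelPoly α) z = (z - α) • B.reproducingKernel z α := by
  refine Matrix.ext_iff_mulVec.2 fun x => ?_
  rw [matEval_shiftedKernelPoly_mulVec, evalAt_kernelVec, Matrix.smul_mulVec]

/-- Representation of the kernel by a pair built from a self-adjoint extension `R` of
`(S - α)⁻¹`: here `M(z) = (z - α) K(z, α)`, and `N(z) E_α = E_z (1 - (z - α) R)`. -/
theorem pair_mul_sub_mul {α : ℝ} {R : B.carrier →ₗ[ℂ] B.carrier}
    (hR : ∀ f g, B.form (R f) g = B.form f (R g)) {N : MatPoly d}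
    (hN : ∀ z (f : B.carrier), (matEval N z).mulVec (evalAt (α : ℂ) (f : VecPoly d)) =
      evalAt z (f : VecPoly d) - (z - α) • evalAt z (R f : VecPoly d)) (z w : ℂ) :
    matEval (B.shiftedKernelPoly α) z * (matEval N w).conjTranspose -
      matEval N z * (matEval (B.shiftedKernelPoly α) w).conjTranspose =
        (z - conj w) • B.reproducingKernel z w := by
  refine Matrix.ext_iff_mulVec.2 fun x => ?_
  -- the adjoint of the identity `N(w) E_α = E_w (1 - (w - α) R)`
  have h1 : B.kernelVec α ((matEval N w).conjTranspose.mulVec x) =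
      B.kernelVec w x - (conj w - α) • R (B.kernelVec w x) := by
    refine B.form_right_inj fun f => ?_
    rw [form_kernelVec, Matrix.star_mulVec, Matrix.conjTranspose_conjTranspose,
      ← Matrix.dotProduct_mulVec, hN, dotProduct_sub, dotProduct_smul, ← form_kernelVec,
      ← form_kernelVec, hR, map_sub, map_smulₛₗ]
    simp
  have h2 : (matEval (B.shiftedKernelPoly α) w).conjTranspose.mulVec x =
      (conj w - α) • evalAt (α : ℂ) (B.kernelVec w x : VecPoly d) := by
    rw [matEval_shiftedKernelPoly, Matrix.conjTranspose_smul, conjTranspose_reproducingKernel,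
      Matrix.smul_mulVec, evalAt_kernelVec]
    simp
  rw [Matrix.sub_mulVec, ← Matrix.mulVec_mulVec, ← Matrix.mulVec_mulVec, h2, Matrix.mulVec_smul,
    hN, matEval_shiftedKernelPoly_mulVec, h1, Matrix.smul_mulVec, ← evalAt_kernelVec]
  simp only [Submodule.coe_sub, Submodule.coe_smul, map_sub, map_smul]
  module

theorem kernelRepresents_of_smul_eq {M N : MatPoly d} {K : ℂ → ℂ → Matrix (Fin d) (Fin d) ℂ}
    (h : ∀ z w, matEval M z * (matEval N w).conjTranspose -
      matEval N z * (matEval M w).conjTranspose = (z - conj w) • K z w) :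
    KernelRepresents M N K := by
  intro z w hzw
  rw [h, smul_smul, inv_mul_cancel₀ (sub_ne_zero.2 hzw), one_smul]

/-- A left null vector of `[M(z)  N(z)]` annihilates `f(z)` for all `f` in the space, because
`K(·, z)` applied to its adjoint vanishes off `z^*`. -/
theorem dotProduct_evalAt_eq_zero {M N : MatPoly d}
    (hK : KernelRepresents M N B.reproducingKernel) {z : ℂ} {x : Fin d → ℂ}
    (hM : Matrix.vecMul x (matEval M z) = 0) (hN : Matrix.vecMul x (matEval N z) = 0)
    (f : B.carrier) : dotProduct x (evalAt z (f : VecPoly d)) = 0 := by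
  have h0 : B.kernelVec z (star x) = 0 := by
    apply Subtype.ext
    refine vecPoly_eq_zero_of_infinite (infinite_ne (conj z)) fun w hw => ?_
    have hzw : z ≠ conj w := fun h => hw (by rw [h, Complex.conj_conj])
    rw [evalAt_kernelVec, ← conjTranspose_reproducingKernel, hK z w hzw, ← star_eq_zero,
      Matrix.star_mulVec, Matrix.conjTranspose_conjTranspose, star_star, Matrix.vecMul_smul,
      Matrix.vecMul_sub, ← Matrix.vecMul_vecMul, ← Matrix.vecMul_vecMul, hM, hN]
    simp
  have := B.form_kernelVec f z (star x)
  rw [h0, map_zero, star_star] at this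
  exact this.symm

/-- The pairs obtained from a self-adjoint extension of `(S - α)⁻¹`: the second matrix polynomial
may be changed by any `G` with `G(z) E_α = 0` without affecting the kernel, and `G` serves to fill
up the rank of the pair. -/
theorem exists_pair (hS : B.IsSymmetric) {α : ℝ} (h : B.RangeCondition α)
    (G : (Fin d → ℂ) →ₗ[ℂ] VecPoly d)
    (hG : ∀ f : B.carrier, G (evalAt (α : ℂ) (f : VecPoly d)) = 0) :
    ∃ M N : MatPoly d,
      (∀ z : ℂ, matEval M z * (matEval N (conj z)).conjTranspose
        - matEval N z * (matEval M (conj z)).conjTranspose = 0) ∧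
      KernelRepresents M N B.reproducingKernel ∧
      ∀ z, (∀ x : Fin d → ℂ, (∀ f : B.carrier, dotProduct x (evalAt z (f : VecPoly d)) = 0) →
        (∀ v, dotProduct x (evalAt z (G v)) = 0) → x = 0) → pairRank M N z = d := by
  obtain ⟨R, hR, hRα⟩ := B.exists_selfAdjoint_resolvent hS h
  obtain ⟨σ, hσ⟩ := B.exists_generalized_inverse α
  let φ : B.carrier →ₗ[ℂ] VecPoly d :=
    B.carrier.subtype - (mulZ - (α : ℂ) • LinearMap.id) ∘ₗ B.carrier.subtype ∘ₗ R
  have hφz : ∀ z f, evalAt z (φ f) =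
      evalAt z (f : VecPoly d) - (z - α) • evalAt z (R f : VecPoly d) := by
    intro z f
    simp [φ, sub_smul]
  have hφ : ∀ f : B.carrier, φ (σ (evalAt (α : ℂ) (f : VecPoly d))) = φ f := by
    intro f
    rw [← sub_eq_zero, ← map_sub]
    have := hRα (σ (evalAt (α : ℂ) (f : VecPoly d)) - f) (by simp [hσ])
    simp only [φ, LinearMap.sub_apply, LinearMap.comp_apply, LinearMap.smul_apply,
      LinearMap.id_apply, Submodule.subtype_apply]
    rw [this, sub_self]
  have hid := B.pair_mul_sub_mul hR (N := matPolyOfLin (φ ∘ₗ σ + G)) fun z f => by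
    rw [matEval_matPolyOfLin_mulVec, LinearMap.add_apply, LinearMap.comp_apply, hφ, hG, add_zero,
      hφz]
  have hK := kernelRepresents_of_smul_eq hid
  refine ⟨_, _, fun z => ?_, hK, fun z hz => (pairRank_eq_iff _ _ z).2 fun x hM hN => ?_⟩
  · rw [hid, Complex.conj_conj, sub_self, zero_smul]
  · have hx := B.dotProduct_evalAt_eq_zero hK hM hN
    refine hz x hx fun v => ?_
    have h1 : dotProduct x (evalAt z ((φ ∘ₗ σ + G) v)) = 0 := by
      rw [← matEval_matPolyOfLin_mulVec, Matrix.dotProduct_mulVec, hN, zero_dotProduct]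
    rw [LinearMap.add_apply, LinearMap.comp_apply, map_add, hφz, dotProduct_add, dotProduct_sub,
      dotProduct_smul, hx, hx] at h1
    simpa using h1

/-- The complementary term `G = 1 - E_α σ` is constant; it gives rank `d` at `α`. -/
theorem isNevanlinnaKernel (hS : B.IsSymmetric) {α : ℝ} (h : B.RangeCondition α) :
    IsNevanlinnaKernel B.reproducingKernel := by
  obtain ⟨σ, hσ⟩ := B.exists_generalized_inverse α
  obtain ⟨M, N, h0, hK, hr⟩ := B.exists_pair hS h
    ((LinearMap.pi fun i => (CAlgHom (R := ℂ)).toLinearMap ∘ₗ LinearMap.proj i) ∘ₗ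
        (LinearMap.id - B.evalOn α ∘ₗ σ)) (fun f => by ext1 i; simp [hσ])
  refine ⟨M, N, ⟨h0, α, hr α fun x hx hG => ?_⟩, hK⟩
  refine dotProduct_eq_zero _ fun v => ?_
  have h1 := hG v
  have h2 : v = evalAt (α : ℂ) (((LinearMap.pi fun i =>
      (CAlgHom (R := ℂ)).toLinearMap ∘ₗ LinearMap.proj i) ∘ₗ
        (LinearMap.id - B.evalOn α ∘ₗ σ)) v) + evalAt (α : ℂ) (σ v : VecPoly d) := by
    ext i; simp
  rw [h2, dotProduct_add, h1, hx, add_zero]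

end PontryaginSpace

/-! ### The generated module over the polynomials and full kernels -/

theorem eval_eq_zero_of_map {ι κ : Type*} (T : (ι → ℂ[X]) →ₗ[ℂ[X]] (κ → ℂ[X])) {z : ℂ}
    {p : ι → ℂ[X]} (hp : ∀ i, (p i).eval z = 0) (j : κ) : (T p j).eval z = 0 := by
  choose q hq using fun i => Polynomial.dvd_iff_isRoot.2 (hp i)
  rw [show p = (X - C z) • q from funext hq, map_smul]
  simp

theorem eval_eq_of_map {ι κ : Type*} (T : (ι → ℂ[X]) →ₗ[ℂ[X]] (κ → ℂ[X])) {z : ℂ}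
    {p q : ι → ℂ[X]} (h : ∀ i, (p i).eval z = (q i).eval z) (j : κ) :
    (T p j).eval z = (T q j).eval z := by
  rw [← sub_eq_zero, ← eval_sub, ← Pi.sub_apply, ← map_sub]
  exact eval_eq_zero_of_map T (fun i => by simp [h]) j

/-- A submodule from which all linear factors can be cancelled is saturated. -/
theorem mem_of_smul_mem {V : Type*} [AddCommGroup V] [Module ℂ[X] V] {P : Submodule ℂ[X] V}
    (h : ∀ (α : ℂ) (g : V), (X - C α) • g ∈ P → g ∈ P) {p : ℂ[X]} (hp : p ≠ 0) {g : V}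
    (hg : p • g ∈ P) : g ∈ P := by
  induction hn : p.natDegree generalizing p with
  | zero =>
    obtain ⟨c, rfl⟩ := Polynomial.natDegree_eq_zero.1 hn
    have hc : c ≠ 0 := fun h => hp (by rw [h, C_0])
    have := P.smul_mem (C c⁻¹) hg
    rwa [smul_smul, ← C_mul, inv_mul_cancel₀ hc, C_1, one_smul] at this
  | succ n ih =>
    obtain ⟨α, hα⟩ := IsAlgClosed.exists_root p (by
      intro h0
      rw [natDegree_eq_of_degree_eq_some h0] at hn
      exact absurd hn (Nat.succ_ne_zero n).symm)
    obtain ⟨q, rfl⟩ := Polynomial.dvd_iff_isRoot.2 hα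
    rw [mul_smul] at hg
    have hq : q ≠ 0 := right_ne_zero_of_mul hp
    refine ih hq (h _ _ hg) ?_
    rw [natDegree_mul (X_sub_C_ne_zero α) hq, natDegree_X_sub_C] at hn
    omega

namespace PontryaginSpace

variable (B : PontryaginSpace d)

/-- The `ℂ[z]`-module generated by the space. -/
noncomputable def polySpan : Submodule ℂ[X] (VecPoly d) :=
  Submodule.span ℂ[X] (B.carrier : Set (VecPoly d))

/-- Every `p = ∑ pᵢ fᵢ` is congruent to `∑ pᵢ(α) fᵢ` modulo `z - α`. -/
theorem exists_eq_add_of_mem_polySpan (α : ℂ) {p : VecPoly d} (hp : p ∈ B.polySpan) :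
    ∃ f ∈ B.carrier, ∃ q ∈ B.polySpan, p = f + (X - C α) • q := by
  induction hp using Submodule.span_induction with
  | mem f hf => exact ⟨f, hf, 0, B.polySpan.zero_mem, by simp⟩
  | zero => exact ⟨0, B.carrier.zero_mem, 0, B.polySpan.zero_mem, by simp⟩
  | add _ _ _ _ h₁ h₂ =>
    obtain ⟨f₁, hf₁, q₁, hq₁, rfl⟩ := h₁
    obtain ⟨f₂, hf₂, q₂, hq₂, rfl⟩ := h₂
    exact ⟨_, B.carrier.add_mem hf₁ hf₂, _, B.polySpan.add_mem hq₁ hq₂, by module⟩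
  | smul a p _ h =>
    obtain ⟨f, hf, q, hq, rfl⟩ := h
    obtain ⟨b, hb⟩ := Polynomial.X_sub_C_dvd_sub_C_eval (p := a) (a := α)
    refine ⟨a.eval α • f, B.carrier.smul_mem _ hf, b • f + a • q, B.polySpan.add_mem
      (B.polySpan.smul_mem _ (Submodule.subset_span hf)) (B.polySpan.smul_mem _ hq), ?_⟩
    have hc : a.eval α • f = C (a.eval α) • f := by
      ext1 i
      simp [Polynomial.smul_eq_C_mul]
    have ha : a • f = C (a.eval α) • f + ((X - C α) * b) • f := by
      rw [← hb]
      module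
    rw [hc, smul_add, ha]
    module

theorem exists_evalAt_eq_of_mem_polySpan (z : ℂ) {p : VecPoly d} (hp : p ∈ B.polySpan) :
    ∃ f : B.carrier, evalAt z (f : VecPoly d) = evalAt z p := by
  obtain ⟨f, hf, q, -, rfl⟩ := B.exists_eq_add_of_mem_polySpan z hp
  exact ⟨⟨f, hf⟩, by ext i; simp⟩

theorem mem_polySpan_of_smul_mem (h : ∀ α, B.RangeCondition α) (α : ℂ) (g : VecPoly d)
    (hg : (X - C α) • g ∈ B.polySpan) : g ∈ B.polySpan := by
  obtain ⟨f, hf, q, hq, e⟩ := B.exists_eq_add_of_mem_polySpan α hg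
  obtain ⟨k, hk⟩ := B.rangeCondition_iff.1 (h α) ⟨f, hf⟩ (by
    change evalAt α f = 0
    rw [eq_sub_iff_add_eq.2 e.symm]
    ext i; simp)
  have hk' : (X - C α) • (k : VecPoly d) = f := by
    rw [← show _ = f from hk]
    ext1 i
    simp [sub_mul, Polynomial.smul_eq_C_mul]
  rw [← hk', ← smul_add] at e
  rw [smul_right_injective _ (X_sub_C_ne_zero α) e]
  exact B.polySpan.add_mem (Submodule.subset_span k.2) hq

/-- If the range condition holds everywhere, the quotient of `ℂ[z]^d` by the generated module is
torsion-free, hence free, so that the module has a complement. -/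
theorem exists_complement (h : ∀ α, B.RangeCondition α) :
    ∃ (n : ℕ) (q : VecPoly d →ₗ[ℂ[X]] (Fin n → ℂ[X])) (s : (Fin n → ℂ[X]) →ₗ[ℂ[X]] VecPoly d),
      q ∘ₗ s = LinearMap.id ∧ LinearMap.ker q = B.polySpan := by
  have htf : Module.IsTorsionFree ℂ[X] (VecPoly d ⧸ B.polySpan) := by
    refine .of_smul_eq_zero fun p m hm => ?_
    obtain ⟨g, rfl⟩ := Submodule.Quotient.mk_surjective _ m
    by_cases hp : p = 0
    · exact Or.inl hp
    · refine Or.inr ((Submodule.Quotient.mk_eq_zero _).2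
        (mem_of_smul_mem (B.mem_polySpan_of_smul_mem h) hp ?_))
      exact (Submodule.Quotient.mk_eq_zero _).1 hm
  let b := Module.finBasis ℂ[X] (VecPoly d ⧸ B.polySpan)
  let q : VecPoly d →ₗ[ℂ[X]] _ := b.equivFun.toLinearMap ∘ₗ B.polySpan.mkQ
  have hq : LinearMap.range q = ⊤ :=
    LinearMap.range_eq_top.2 (b.equivFun.surjective.comp B.polySpan.mkQ_surjective)
  obtain ⟨s, hs⟩ := q.exists_rightInverse_of_surjective hq
  refine ⟨_, q, s, hs, ?_⟩
  rw [LinearEquiv.ker_comp, Submodule.ker_mkQ]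

/-- With the projection `q` and the section `s` of a complement of the generated module, the term
`G(z) = s(z) q(α)` fills up the rank of the pair at every `z`. -/
theorem isFullNevanlinnaKernel (hS : B.IsSymmetric) (h : ∀ α, B.RangeCondition α) :
    IsFullNevanlinnaKernel B.reproducingKernel := by
  obtain ⟨n, q, s, hqs, hker⟩ := B.exists_complement h
  have hqs' : ∀ p, q (s p) = p := fun p => congrArg (fun T => T p) hqs
  -- the real base point `α = 0` is as good as any other
  let G : (Fin d → ℂ) →ₗ[ℂ] VecPoly d :=
    { toFun := fun v => s fun i => C ((q (fun j => C (v j)) i).eval 0)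
      map_add' := fun v w => by
        rw [← map_add]
        congr 1
        ext1 i
        rw [show (fun j => C ((v + w) j)) = (fun j => C (v j)) + fun j => C (w j) from
          funext fun j => C_add, map_add]
        simp
      map_smul' := fun c v => by
        rw [RingHom.id_apply]
        have hc : ∀ (m : ℕ) (p : Fin m → ℂ[X]), c • p = C c • p := fun m p => by
          ext1 i; simp [Polynomial.smul_eq_C_mul]
        rw [hc, ← map_smul]
        congr 1
        ext1 i
        rw [show (fun j => C ((c • v) j)) = C c • (fun j => C (v j)) from
          funext fun j => C_mul, map_smul]
        simp }
  have hGv : ∀ v, G v = s fun i => C ((q (fun j => C (v j)) i).eval 0) := fun v => rfl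
  have hG : ∀ f : B.carrier, G (evalAt ((0 : ℝ) : ℂ) (f : VecPoly d)) = 0 := by
    intro f
    have hf : q f = 0 := by
      rw [← LinearMap.mem_ker, hker]
      exact Submodule.subset_span f.2
    rw [hGv, ← map_zero s]
    congr 1
    ext1 i
    rw [eval_eq_of_map q (q := (f : VecPoly d)) (fun j => by simp), hf]
    simp
  obtain ⟨M, N, h0, hK, hr⟩ := B.exists_pair hS (h _) G hG
  have hfull : ∀ z, pairRank M N z = d := by
    refine fun z => hr z fun x hx hxG => dotProduct_eq_zero _ fun y => ?_
    -- `x` annihilates the whole range of `s(z)`, as `q(0)` is onto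
    have hs : ∀ p, dotProduct x (evalAt z (s p)) = 0 := by
      intro p
      have e : evalAt z (s p) = evalAt z (G (evalAt 0 (s fun i => C ((p i).eval z)))) := by
        ext j
        rw [evalAt_apply, evalAt_apply, hGv]
        refine eval_eq_of_map s (fun i => ?_) j
        rw [eval_C, eval_eq_of_map q (q := s fun i => C ((p i).eval z)) (fun j => by simp), hqs']
        simp
      rw [e, hxG]
    have hy : (fun j => C (y j)) - s (q fun j => C (y j)) ∈ B.polySpan := by
      rw [← hker, LinearMap.mem_ker, map_sub, hqs', sub_self]
    obtain ⟨f, hf⟩ := B.exists_evalAt_eq_of_mem_polySpan z hy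
    have e : y = evalAt z (f : VecPoly d) + evalAt z (s (q fun j => C (y j))) := by
      rw [hf, ← map_add, sub_add_cancel]
      ext j; simp
    rw [e, dotProduct_add, hx, hs, add_zero]
  exact ⟨M, N, ⟨h0, 0, hfull 0⟩, hK, hfull⟩

end PontryaginSpace

end PolyPontryagin

theorem theorem1p1 (d : ℕ) (B : PolyPontryagin.PontryaginSpace d) :
    (PolyPontryagin.IsNevanlinnaKernel B.reproducingKernel ↔
      (B.IsSymmetric ∧ ∃ α : ℂ, B.RangeCondition α)) ∧
    (PolyPontryagin.IsNevanlinnaKernel B.reproducingKernel →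
      (PolyPontryagin.IsFullNevanlinnaKernel B.reproducingKernel ↔
        ∀ α : ℂ, B.RangeCondition α)) := by
  have hsymm : PolyPontryagin.IsNevanlinnaKernel B.reproducingKernel →
      B.IsSymmetric ∧ ∃ α : ℂ, B.RangeCondition α := by
    rintro ⟨M, N, hp, hK⟩
    obtain ⟨z₀, hz₀⟩ := hp.2
    -- a real point, where the rank is full at `α` and `α^*` at once
    obtain ⟨α, hα⟩ := PolyPontryagin.exists_real_pairRank_eq M N hz₀
    have hα' : PolyPontryagin.pairRank M N (starRingEnd ℂ α) = d := by
      rwa [Complex.conj_ofReal]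
    exact ⟨PolyPontryagin.PontryaginSpace.isSymmetric_of_pairRank hp hK hα hα', α,
      PolyPontryagin.PontryaginSpace.rangeCondition_of_pairRank hp hK hα hα'⟩
  refine ⟨⟨hsymm, ?_⟩, fun hN => ⟨?_, fun h => B.isFullNevanlinnaKernel (hsymm hN).1 h⟩⟩
  · rintro ⟨hS, α₀, h⟩
    obtain ⟨α, hα⟩ := B.exists_real_rangeCondition h
    exact B.isNevanlinnaKernel hS hα
  · rintro ⟨M, N, hp, hK, hfull⟩ α
    exact PolyPontryagin.PontryaginSpace.rangeCondition_of_pairRank hp hK (hfull α) (hfull _)
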